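/- Let $\Omega=[-1,1]^2\subset\mathbb{R}^2$, with area $|\Omega|=4$, and let $H^2(\Omega)$ be the Sobolev space of real-valued functions in $L^2(\Omega)$ whose first and second order weak derivatives (on the interior of $\Omega$) are in $L^2(\Omega)$. Let $$X_2=\{u\in H^2(\Omega) : \partial_\nu u|_{\partial\Omega}=0\},$$ where $\nu$ is the exterior unit normal and $\partial_\nu u=\nu\cdot\nabla u$ on $\partial\Omega$, the boundary values of $\nabla u$ being taken in the sense of traces $H^1(\Omega)\to L^2(\partial\Omega)$. For $u\in X_2$ let $\Delta u=\partial_1^2u+\partial_2^2u$ and $Hu=(\partial_i\partial_ju)_{i,j=1}^2$ be the weak Laplacian and the weak Hessian matrix, let $|M|_F^2=\sum_{i,j}M_{ij}^2$, and let $$R_2[u]=\frac{1}{2|\Omega|}\int_\Omega(\Delta u)^2\,dx,\qquad R_3[u]=\frac{1}{2|\Omega|}\int_\Omega|Hu|_F^2\,dx .$$ Then for every $u\in X_2$ both integrals are finite and $R_2[u]=R_3[u]$. -/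

import Mathlib

open MeasureTheory Filter Topology
open scoped ContDiff

noncomputable section

namespace SquareReg

/-- Points of the plane.  Only the topology and Lebesgue measure of the plane are used below. -/
abbrev Plane : Type := Fin 2 → ℝ

/-- The square `Ω = [-1,1]²`. -/
def Ω : Set Plane := Set.Icc (fun _ => -1) (fun _ => 1)

/-- Lebesgue measure on the square. -/
def lebΩ : Measure Plane := volume.restrict Ω

/-- The classical partial derivative `∂ᵢ φ`. -/
def partialDeriv (i : Fin 2) (φ : Plane → ℝ) (x : Plane) : ℝ :=
  fderiv ℝ φ x (Pi.single i 1)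

/-- `g` is a weak `i`-th partial derivative of `u` in the interior of the square: both are
locally integrable there and `∫ u ∂ᵢφ = -∫ g φ` for all smooth `φ` compactly supported there. -/
structure HasWeakPartial (i : Fin 2) (u g : Plane → ℝ) : Prop where
  locallyIntegrable : LocallyIntegrableOn u (interior Ω) volume
  locallyIntegrable_deriv : LocallyIntegrableOn g (interior Ω) volume
  integral_eq : ∀ φ : Plane → ℝ, ContDiff ℝ ∞ φ → HasCompactSupport φ →
    tsupport φ ⊆ interior Ω →
      ∫ x in Ω, u x * partialDeriv i φ x = -∫ x in Ω, g x * φ x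

open Classical in
/-- The weak partial derivative `∂ᵢ u`, unique up to equality almost everywhere on the square;
a representative is chosen. (It is `0` if there is none.) -/
def weakPartial (i : Fin 2) (u : Plane → ℝ) : Plane → ℝ :=
  if h : ∃ g, HasWeakPartial i u g then h.choose else 0

/-- `u ∈ H¹(Ω)`: `u` and its first order weak derivatives are in `L²(Ω)`. -/
def MemH1 (u : Plane → ℝ) : Prop :=
  MemLp u 2 lebΩ ∧ ∀ i, ∃ g, HasWeakPartial i u g ∧ MemLp g 2 lebΩ

/-- `u ∈ H²(Ω)`: `u` and its first and second order weak derivatives are in `L²(Ω)`. -/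
def MemH2 (u : Plane → ℝ) : Prop :=
  MemLp u 2 lebΩ ∧ ∀ i, ∃ g, HasWeakPartial i u g ∧ MemH1 g

/-- The boundary of the square consists of four edges, one for each `i : Fin 2` and
`s ∈ {-1, 1}`.  This is the unit speed parametrization, over `t ∈ [-1,1]`, of the edge
`{x ∈ Ω | xᵢ = s}`: its `i`-th coordinate is `s` and the other one is `t`. -/
def edge (i : Fin 2) (s t : ℝ) : Plane := Function.update (fun _ => t) i s

/-- Arc length on an edge, in the parametrization `edge i s`. -/
def arcLength : Measure ℝ := volume.restrict (Set.Icc (-1) 1)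

/-- The exterior unit normal `s eᵢ` on the edge `{x ∈ Ω | xᵢ = s}`, where `s ∈ {-1, 1}`. -/
def outerNormal (i : Fin 2) (s : ℝ) : Plane := Pi.single i s

/-- `τ ∈ L²(∂Ω)` is the boundary trace of `v ∈ H¹(Ω)`: the trace operator `H¹(Ω) → L²(∂Ω)` is
the continuous extension of the restriction of smooth functions to the boundary, that is,
there are smooth `wₖ` with `wₖ → v` in `H¹(Ω)` and `wₖ|∂Ω → τ` in `L²(∂Ω)`. -/
structure IsTrace (v τ : Plane → ℝ) : Prop where
  memH1 : MemH1 v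
  memLp : ∀ i, ∀ s ∈ ({-1, 1} : Set ℝ), MemLp (fun t => τ (edge i s t)) 2 arcLength
  exists_seq : ∃ w : ℕ → Plane → ℝ, (∀ k, ContDiff ℝ ∞ (w k)) ∧
    Tendsto (fun k => eLpNorm (fun x => w k x - v x) 2 lebΩ) atTop (𝓝 0) ∧
    (∀ j, Tendsto
      (fun k => eLpNorm (fun x => partialDeriv j (w k) x - weakPartial j v x) 2 lebΩ)
      atTop (𝓝 0)) ∧
    ∀ i, ∀ s ∈ ({-1, 1} : Set ℝ), Tendsto
      (fun k => eLpNorm (fun t => w k (edge i s t) - τ (edge i s t)) 2 arcLength)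
      atTop (𝓝 0)

/-- `∂_ν u = g` on `∂Ω`: almost everywhere on every edge, `g` is the scalar product of the
exterior unit normal with the trace of the weak gradient of `u`. -/
def HasNormalDeriv (u g : Plane → ℝ) : Prop :=
  ∃ τ : Fin 2 → Plane → ℝ, (∀ j, IsTrace (weakPartial j u) (τ j)) ∧
    ∀ i, ∀ s ∈ ({-1, 1} : Set ℝ), ∀ᵐ t ∂arcLength,
      ∑ j, outerNormal i s j * τ j (edge i s t) = g (edge i s t)

/-- The space `X₂` of all `u ∈ H²(Ω)` with `∂_ν u = 0` on `∂Ω`. -/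
def X₂ : Set (Plane → ℝ) := {u | MemH2 u ∧ HasNormalDeriv u 0}

/-- The weak Hessian matrix `(Hu)ᵢⱼ = ∂ᵢ ∂ⱼ u`. -/
def hessian (u : Plane → ℝ) (x : Plane) : Matrix (Fin 2) (Fin 2) ℝ :=
  Matrix.of fun i j => weakPartial i (weakPartial j u) x

/-- The weak Laplacian `Δu = ∂₁∂₁ u + ∂₂∂₂ u`. -/
def laplacian (u : Plane → ℝ) (x : Plane) : ℝ :=
  ∑ i, weakPartial i (weakPartial i u) x

/-- The squared Frobenius norm `|M|_F²`. -/
def frobSq (M : Matrix (Fin 2) (Fin 2) ℝ) : ℝ := ∑ i, ∑ j, M i j ^ 2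

/-- The area `|Ω|`. -/
def area : ℝ := (volume Ω).toReal

/-- The Laplacian regularizer `R₂`. -/
def R₂ (u : Plane → ℝ) : ℝ := 1 / (2 * area) * ∫ x in Ω, laplacian u x ^ 2

/-- The Hessian regularizer `R₃`. -/
def R₃ (u : Plane → ℝ) : ℝ := 1 / (2 * area) * ∫ x in Ω, frobSq (hessian u x)

end SquareReg

end

/-!
The squared Laplacian and the squared Frobenius norm of the Hessian of `u` differ by twice the
Hessian determinant, because weak second derivatives commute (`weakPartial_comm`). So the theorem
says that the determinant `∂₀p ∂₁q - ∂₁p ∂₀q` has zero integral, where `(p, q)` is the weak gradient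
of `u`. The Neumann condition says that the trace of `p` vanishes on the edges `x₀ = ±1`
and that of `q` on the edges `x₁ = ±1`.

The smooth approximations behind the traces need not satisfy these conditions exactly, and their
tangential derivatives on the boundary are not controlled, so the integral of the determinant cannot
be moved to the boundary directly. Fourier series avoid this. Expand `∂₀p` and `∂₁q` in
`cos (k θ₀) cos (l θ₁)`, and `∂₁p` and `∂₀q` in `sin (k θ₀) sin (l θ₁)`, where
`θᵢ = π (xᵢ + 1) / 2`. Integration by parts against these smooth functions
(`IsTrace.integral_weakPartial_mul_eq_neg`) has no boundary terms and expresses all coefficients by the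
coefficients `P k l` of `p` in `sin (k θ₀) cos (l θ₁)` and `Q k l` of `q` in
`cos (k θ₀) sin (l θ₁)`. By Parseval's identity both `∫ ∂₀p ∂₁q` and `∫ ∂₁p ∂₀q` are then the sum
of `(π / 2)² k l P k l Q k l` over `k, l ≥ 1` (`integral_weakPartial_mul_weakPartial`).

Parseval's identity requires that both families of products are complete in `L²`. For the cosines
this is the Stone–Weierstrass theorem, since their span is an algebra separating the points of the
square; the sines are reduced to the cosines by multiplying with the first sine mode.
-/

namespace SquareReg

/-! ### Integration in `L²` -/

section L2

variable {α : Type*} [MeasurableSpace α] {μ : Measure α}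

/-- Convergence in `L²` may be tested against a fixed `L²` function. -/
theorem tendsto_integral_mul_of_tendsto_eLpNorm {w : ℕ → α → ℝ} {v f : α → ℝ}
    (hw : ∀ k, MemLp (w k) 2 μ) (hv : MemLp v 2 μ) (hf : MemLp f 2 μ)
    (h : Tendsto (fun k => eLpNorm (fun x => w k x - v x) 2 μ) atTop (𝓝 0)) :
    Tendsto (fun k => ∫ x, w k x * f x ∂μ) atTop (𝓝 (∫ x, v x * f x ∂μ)) := by
  refine tendsto_integral_of_L1' (fun x => v x * f x) (hv.integrable_mul hf).aestronglyMeasurable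
    (Eventually.of_forall fun k => (hw k).integrable_mul hf) ?_
  have hlim : Tendsto (fun k => eLpNorm (fun x => w k x - v x) 2 μ * eLpNorm f 2 μ) atTop
      (𝓝 0) := by
    simpa using ENNReal.Tendsto.mul_const h (Or.inr hf.eLpNorm_ne_top)
  refine tendsto_of_tendsto_of_tendsto_of_le_of_le tendsto_const_nhds hlim
    (fun _ => zero_le) fun k => ?_
  have := eLpNorm_smul_le_mul_eLpNorm (p := 2) (q := 2) (r := 1) hf.aestronglyMeasurable
    ((hw k).sub hv).aestronglyMeasurable
  refine le_trans (le_of_eq ?_) this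
  congr 1
  ext x
  simp [sub_mul]

theorem inner_toLp_eq_integral {f g : α → ℝ} (hf : MemLp f 2 μ) (hg : MemLp g 2 μ) :
    inner ℝ (hf.toLp f) (hg.toLp g) = ∫ x, f x * g x ∂μ := by
  rw [L2.inner_def]
  refine integral_congr_ae ?_
  filter_upwards [hf.coeFn_toLp, hg.coeFn_toLp] with x h1 h2
  rw [h1, h2]
  simp [mul_comm]

/-- Parseval's identity for an orthonormal family in `L²` whose only orthogonal function is zero. -/
theorem hasSum_integral_mul_integral {ι : Type*} {e : ι → α → ℝ} (he : ∀ i, MemLp (e i) 2 μ)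
    (hone : ∀ i, ∫ x, e i x * e i x ∂μ = 1)
    (horth : ∀ i j, i ≠ j → ∫ x, e i x * e j x ∂μ = 0)
    (hcomplete : ∀ h, MemLp h 2 μ → (∀ i, ∫ x, h x * e i x ∂μ = 0) → h =ᵐ[μ] 0)
    {f g : α → ℝ} (hf : MemLp f 2 μ) (hg : MemLp g 2 μ) :
    HasSum (fun i => (∫ x, f x * e i x ∂μ) * ∫ x, g x * e i x ∂μ) (∫ x, f x * g x ∂μ) := by
  have hon : Orthonormal ℝ fun i => (he i).toLp (e i) := by
    refine ⟨fun i => ?_, fun i j hij => ?_⟩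
    · have h := inner_toLp_eq_integral (he i) (he i)
      rw [hone, real_inner_self_eq_norm_sq] at h
      nlinarith [norm_nonneg ((he i).toLp (e i))]
    · exact (inner_toLp_eq_integral (he i) (he j)).trans (horth i j hij)
  have hbot : (Submodule.span ℝ (Set.range fun i => (he i).toLp (e i)))ᗮ = ⊥ := by
    rw [Submodule.eq_bot_iff]
    intro h hh
    rw [Submodule.mem_orthogonal'] at hh
    have hmem := Lp.memLp h
    have hz : (h : α → ℝ) =ᵐ[μ] 0 := by
      refine hcomplete h hmem fun i => ?_
      rw [← inner_toLp_eq_integral hmem (he i), Lp.toLp_coeFn]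
      exact hh _ (Submodule.subset_span ⟨i, rfl⟩)
    exact (Lp.eq_zero_iff_ae_eq_zero).2 hz
  have hs := (HilbertBasis.mkOfOrthogonalEqBot hon hbot).hasSum_inner_mul_inner
    (hf.toLp f) (hg.toLp g)
  simp only [HilbertBasis.coe_mkOfOrthogonalEqBot, inner_toLp_eq_integral] at hs
  simpa only [mul_comm] using hs

end L2

/-! ### The square -/

theorem isCompact_Ω : IsCompact Ω := isCompact_Icc

theorem measurableSet_Ω : MeasurableSet Ω := isCompact_Ω.measurableSet

instance isFiniteMeasure_lebΩ : IsFiniteMeasure lebΩ :=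
  ⟨by rw [lebΩ, Measure.restrict_apply_univ]; exact isCompact_Ω.measure_lt_top⟩

instance isFiniteMeasure_arcLength : IsFiniteMeasure arcLength := by
  unfold arcLength; infer_instance

theorem interior_Ω_ae_eq : interior Ω =ᵐ[volume] Ω :=
  interior_ae_eq_of_null_frontier ((convex_Icc _ _).addHaar_frontier volume)

theorem memLp_two_lebΩ_of_continuous {f : Plane → ℝ} (hf : Continuous f) : MemLp f 2 lebΩ := by
  obtain ⟨C, hC⟩ := isCompact_Ω.exists_bound_of_continuousOn hf.continuousOn
  exact MemLp.of_bound hf.aestronglyMeasurable C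
    ((ae_restrict_iff' measurableSet_Ω).2 (ae_of_all _ hC))

theorem memLp_two_arcLength_of_continuous {f : ℝ → ℝ} (hf : Continuous f) :
    MemLp f 2 arcLength := by
  obtain ⟨C, hC⟩ := isCompact_Icc.exists_bound_of_continuousOn (s := Set.Icc (-1 : ℝ) 1)
    hf.continuousOn
  exact MemLp.of_bound hf.aestronglyMeasurable C
    ((ae_restrict_iff' measurableSet_Icc).2 (ae_of_all _ hC))

theorem edge_zero (s t : ℝ) : edge 0 s t = ![s, t] := by
  ext j; fin_cases j <;> simp [edge]

theorem edge_one (s t : ℝ) : edge 1 s t = ![t, s] := by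
  ext j; fin_cases j <;> simp [edge]

theorem continuous_edge (i : Fin 2) (s : ℝ) : Continuous (edge i s) := by
  unfold edge; fun_prop

/-- Fubini's theorem on the square, the inner integral being taken along the `i`-th direction. -/
theorem integral_lebΩ_eq (i : Fin 2) {F : Plane → ℝ} (hF : Continuous F) :
    ∫ x, F x ∂lebΩ = ∫ t, ∫ s, F (edge i s t) ∂arcLength ∂arcLength := by
  have hpre : Ω = MeasurableEquiv.finTwoArrow ⁻¹'
      (Set.Icc (-1 : ℝ) 1 ×ˢ Set.Icc (-1 : ℝ) 1) := by
    ext x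
    simp [Ω, Pi.le_def, Fin.forall_fin_two, MeasurableEquiv.finTwoArrow, and_and_and_comm]
  have hcont : Continuous fun z : ℝ × ℝ => F ![z.1, z.2] := by fun_prop
  have hint : IntegrableOn (fun z : ℝ × ℝ => F ![z.1, z.2])
      (Set.Icc (-1 : ℝ) 1 ×ˢ Set.Icc (-1 : ℝ) 1) (volume.prod volume) :=
    hcont.continuousOn.integrableOn_compact (isCompact_Icc.prod isCompact_Icc)
  have key : ∫ x, F x ∂lebΩ = ∫ z in Set.Icc (-1 : ℝ) 1 ×ˢ Set.Icc (-1 : ℝ) 1,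
      F ![z.1, z.2] ∂(volume.prod volume) := by
    rw [lebΩ, hpre, ← Measure.volume_eq_prod,
      ← (volume_preserving_finTwoArrow ℝ).setIntegral_preimage_emb
      MeasurableEquiv.finTwoArrow.measurableEmbedding]
    refine integral_congr_ae (ae_of_all _ fun x => congrArg F ?_)
    ext j; fin_cases j <;> rfl
  rw [key]
  fin_cases i
  · simp only [Fin.zero_eta, edge_zero]
    rw [setIntegral_prod _ hint]
    exact integral_integral_swap (by rw [Measure.prod_restrict]; exact hint)
  · simp only [Fin.mk_one, edge_one]
    exact setIntegral_prod _ hint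

theorem integral_arcLength_eq_intervalIntegral (f : ℝ → ℝ) :
    ∫ t, f t ∂arcLength = ∫ t in (-1 : ℝ)..1, f t := by
  rw [intervalIntegral.integral_of_le (by norm_num), ← integral_Icc_eq_integral_Ioc, arcLength]

theorem hasDerivAt_comp_edge {F : Plane → ℝ} (hF : ContDiff ℝ ∞ F) (i : Fin 2) (s t : ℝ) :
    HasDerivAt (fun r => F (edge i r t)) (partialDeriv i F (edge i s t)) s := by
  have h1 : HasFDerivAt F (fderiv ℝ F (edge i s t)) (edge i s t) :=
    (hF.differentiable (by simp) _).hasFDerivAt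
  exact h1.comp_hasDerivAt s (hasDerivAt_update (fun _ => t) i s)

theorem continuous_partialDeriv {F : Plane → ℝ} (hF : ContDiff ℝ ∞ F) (i : Fin 2) :
    Continuous (partialDeriv i F) := by
  have := hF.continuous_fderiv (by simp)
  unfold partialDeriv
  fun_prop

theorem partialDeriv_mul {F G : Plane → ℝ} (hF : ContDiff ℝ ∞ F) (hG : ContDiff ℝ ∞ G)
    (i : Fin 2) (x : Plane) :
    partialDeriv i (fun y => F y * G y) x
      = partialDeriv i F x * G x + F x * partialDeriv i G x := by
  unfold partialDeriv
  rw [fderiv_fun_mul (hF.differentiable (by simp) x) (hG.differentiable (by simp) x)]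
  simp
  ring

/-- The divergence theorem on the square for a smooth vector field with only one component. -/
theorem integral_partialDeriv {F : Plane → ℝ} (hF : ContDiff ℝ ∞ F) (i : Fin 2) :
    ∫ x, partialDeriv i F x ∂lebΩ
      = (∫ t, F (edge i 1 t) ∂arcLength) - ∫ t, F (edge i (-1) t) ∂arcLength := by
  rw [integral_lebΩ_eq i (continuous_partialDeriv hF i), ← integral_sub]
  · refine integral_congr_ae (ae_of_all _ fun t => ?_)
    simp only
    rw [integral_arcLength_eq_intervalIntegral]
    refine intervalIntegral.integral_eq_sub_of_hasDerivAt
      (fun s _ => hasDerivAt_comp_edge hF i s t) (Continuous.intervalIntegrable ?_ _ _)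
    refine (continuous_partialDeriv hF i).comp ?_
    unfold edge; fun_prop
  all_goals
    exact (memLp_two_arcLength_of_continuous
      (hF.continuous.comp (continuous_edge i _))).integrable (by norm_num)

/-! ### Weak derivatives and traces -/

/-- Two locally integrable functions with the same integrals against all test functions on the
open square agree almost everywhere on the square. -/
theorem ae_eq_of_integral_mul_eq {f g : Plane → ℝ}
    (hf : LocallyIntegrableOn f (interior Ω) volume)
    (hg : LocallyIntegrableOn g (interior Ω) volume)
    (h : ∀ φ : Plane → ℝ, ContDiff ℝ ∞ φ → HasCompactSupport φ → tsupport φ ⊆ interior Ω →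
      ∫ x in Ω, f x * φ x = ∫ x in Ω, g x * φ x) :
    f =ᵐ[lebΩ] g := by
  have key := isOpen_interior.ae_eq_zero_of_integral_contDiff_smul_eq_zero (hf.sub hg) ?_
  · rw [lebΩ, ← Measure.restrict_congr_set interior_Ω_ae_eq]
    refine (ae_restrict_iff' isOpen_interior.measurableSet).2 ?_
    filter_upwards [key] with x hx hxΩ
    exact sub_eq_zero.1 (hx hxΩ)
  · intro φ hφ hφc hφs
    have hint : ∀ a : Plane → ℝ, LocallyIntegrableOn a (interior Ω) volume →
        Integrable (fun x => φ x • a x) volume := fun a ha => by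
      refine (integrableOn_iff_integrable_of_support_subset fun x hx => ?_).1
        ((ha.integrableOn_compact_subset hφs hφc).continuousOn_smul hφ.continuous.continuousOn hφc)
      exact subset_tsupport φ fun h0 => hx (by simp [h0])
    have hΩ : ∀ a : Plane → ℝ, ∫ x, φ x • a x = ∫ x in Ω, a x * φ x := fun a => by
      rw [setIntegral_eq_integral_of_forall_compl_eq_zero]
      · simp only [smul_eq_mul, mul_comm]
      · intro x hx
        rw [image_eq_zero_of_notMem_tsupport fun hx' => hx (interior_subset (hφs hx')), mul_zero]
    simp only [Pi.sub_apply, smul_sub]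
    rw [integral_sub (hint f hf) (hint g hg), hΩ, hΩ, h φ hφ hφc hφs, sub_self]

theorem hasWeakPartial_weakPartial {i : Fin 2} {u : Plane → ℝ} (h : ∃ g, HasWeakPartial i u g) :
    HasWeakPartial i u (weakPartial i u) := by
  rw [weakPartial, dif_pos h]
  exact h.choose_spec

theorem MemH1.hasWeakPartial {u : Plane → ℝ} (h : MemH1 u) (i : Fin 2) :
    HasWeakPartial i u (weakPartial i u) :=
  hasWeakPartial_weakPartial ((h.2 i).imp fun _ hg => hg.1)

theorem MemH1.memLp_weakPartial {u : Plane → ℝ} (h : MemH1 u) (i : Fin 2) :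
    MemLp (weakPartial i u) 2 lebΩ := by
  obtain ⟨g, hg, hg2⟩ := h.2 i
  have hw := h.hasWeakPartial i
  refine (memLp_congr_ae (ae_eq_of_integral_mul_eq hg.locallyIntegrable_deriv
    hw.locallyIntegrable_deriv fun φ h1 h2 h3 => ?_)).1 hg2
  have := (hg.integral_eq φ h1 h2 h3).symm.trans (hw.integral_eq φ h1 h2 h3)
  linarith

theorem contDiff_partialDeriv {F : Plane → ℝ} (hF : ContDiff ℝ ∞ F) (i : Fin 2) :
    ContDiff ℝ ∞ (partialDeriv i F) :=
  (hF.fderiv_right (m := ∞) (by simp)).clm_apply contDiff_const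

theorem tsupport_partialDeriv_subset (F : Plane → ℝ) (i : Fin 2) :
    tsupport (partialDeriv i F) ⊆ tsupport F :=
  tsupport_fderiv_apply_subset ℝ _

theorem partialDeriv_comm {F : Plane → ℝ} (hF : ContDiff ℝ ∞ F) (i j : Fin 2) (x : Plane) :
    partialDeriv i (partialDeriv j F) x = partialDeriv j (partialDeriv i F) x := by
  have hsymm : IsSymmSndFDerivAt ℝ F x := hF.contDiffAt.isSymmSndFDerivAt
    (by simpa using WithTop.coe_le_coe.2 (le_top : (2 : ℕ∞) ≤ ⊤))
  have hd : Differentiable ℝ (fderiv ℝ F) :=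
    (hF.fderiv_right (m := ∞) (by simp)).differentiable (by simp)
  have h : ∀ a b : Fin 2, partialDeriv a (partialDeriv b F) x
      = fderiv ℝ (fderiv ℝ F) x (Pi.single a 1) (Pi.single b 1) := by
    intro a b
    unfold partialDeriv
    rw [fderiv_clm_apply (hd x) (differentiableAt_const _)]
    simp
  rw [h, h, hsymm]

/-- Weak second derivatives commute. -/
theorem weakPartial_comm {u : Plane → ℝ} (i j : Fin 2) (hi : ∃ g, HasWeakPartial i u g)
    (hj : ∃ g, HasWeakPartial j u g) (hHi : MemH1 (weakPartial i u))
    (hHj : MemH1 (weakPartial j u)) :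
    weakPartial i (weakPartial j u) =ᵐ[lebΩ] weakPartial j (weakPartial i u) := by
  have hij := hHj.hasWeakPartial i
  have hji := hHi.hasWeakPartial j
  refine ae_eq_of_integral_mul_eq hij.locallyIntegrable_deriv hji.locallyIntegrable_deriv
    fun φ h1 h2 h3 => ?_
  have hc : ∀ a, HasCompactSupport (partialDeriv a φ) := fun a =>
    h2.mono' ((subset_tsupport _).trans (tsupport_partialDeriv_subset φ a))
  have e1 := hij.integral_eq φ h1 h2 h3
  have e2 := hji.integral_eq φ h1 h2 h3
  have e3 := (hasWeakPartial_weakPartial hj).integral_eq _ (contDiff_partialDeriv h1 i) (hc i)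
    ((tsupport_partialDeriv_subset φ i).trans h3)
  have e4 := (hasWeakPartial_weakPartial hi).integral_eq _ (contDiff_partialDeriv h1 j) (hc j)
    ((tsupport_partialDeriv_subset φ j).trans h3)
  simp only [partialDeriv_comm h1 i j] at e4
  simp only [partialDeriv_comm h1 j i] at e3 e4
  linarith

/-- Integration by parts for a function with a trace, against a smooth function on the plane. -/
theorem IsTrace.integral_weakPartial_mul {v τ : Plane → ℝ} (h : IsTrace v τ) (i : Fin 2)
    {f : Plane → ℝ} (hf : ContDiff ℝ ∞ f) :
    ∫ x, weakPartial i v x * f x ∂lebΩ + ∫ x, v x * partialDeriv i f x ∂lebΩ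
      = (∫ t, τ (edge i 1 t) * f (edge i 1 t) ∂arcLength)
        - ∫ t, τ (edge i (-1) t) * f (edge i (-1) t) ∂arcLength := by
  obtain ⟨w, hw, hw0, hw1, hwb⟩ := h.exists_seq
  have hL : Tendsto (fun k => ∫ x, partialDeriv i (w k) x * f x ∂lebΩ
      + ∫ x, w k x * partialDeriv i f x ∂lebΩ) atTop
      (𝓝 (∫ x, weakPartial i v x * f x ∂lebΩ + ∫ x, v x * partialDeriv i f x ∂lebΩ)) :=
    (tendsto_integral_mul_of_tendsto_eLpNorm
      (fun k => memLp_two_lebΩ_of_continuous (continuous_partialDeriv (hw k) i))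
      (h.memH1.memLp_weakPartial i) (memLp_two_lebΩ_of_continuous hf.continuous) (hw1 i)).add
    (tendsto_integral_mul_of_tendsto_eLpNorm
      (fun k => memLp_two_lebΩ_of_continuous (hw k).continuous) h.memH1.1
      (memLp_two_lebΩ_of_continuous (continuous_partialDeriv hf i)) hw0)
  have hb : ∀ s ∈ ({-1, 1} : Set ℝ), Tendsto
      (fun k => ∫ t, w k (edge i s t) * f (edge i s t) ∂arcLength) atTop
      (𝓝 (∫ t, τ (edge i s t) * f (edge i s t) ∂arcLength)) := fun s hs =>
    tendsto_integral_mul_of_tendsto_eLpNorm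
      (fun k => memLp_two_arcLength_of_continuous ((hw k).continuous.comp (continuous_edge i s)))
      (h.memLp i s hs)
      (memLp_two_arcLength_of_continuous (hf.continuous.comp (continuous_edge i s))) (hwb i s hs)
  refine tendsto_nhds_unique hL (((hb 1 (by simp)).sub (hb (-1) (by simp))).congr fun k => ?_)
  rw [← integral_partialDeriv ((hw k).mul hf) i]
  simp only [partialDeriv_mul (hw k) hf]
  rw [integral_add]
  · exact (memLp_two_lebΩ_of_continuous (continuous_partialDeriv (hw k) i)).integrable_mul
      (memLp_two_lebΩ_of_continuous hf.continuous)
  · exact (memLp_two_lebΩ_of_continuous (hw k).continuous).integrable_mul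
      (memLp_two_lebΩ_of_continuous (continuous_partialDeriv hf i))

/-! ### Trigonometric modes on `[-1,1]` -/

/-- The cosine mode of frequency `k`; on `[-1,1]`, these are the Neumann eigenfunctions. -/
noncomputable def cosMode (k : ℤ) (t : ℝ) : ℝ := Real.cos (k * (Real.pi / 2) * (t + 1))

/-- The sine mode of frequency `k`; on `[-1,1]`, these are the Dirichlet eigenfunctions. -/
noncomputable def sinMode (k : ℤ) (t : ℝ) : ℝ := Real.sin (k * (Real.pi / 2) * (t + 1))

theorem contDiff_cosMode (k : ℤ) : ContDiff ℝ ∞ (cosMode k) := by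
  unfold cosMode; fun_prop

theorem contDiff_sinMode (k : ℤ) : ContDiff ℝ ∞ (sinMode k) := by
  unfold sinMode; fun_prop

theorem continuous_cosMode (k : ℤ) : Continuous (cosMode k) := (contDiff_cosMode k).continuous

theorem continuous_sinMode (k : ℤ) : Continuous (sinMode k) := (contDiff_sinMode k).continuous

theorem hasDerivAt_mode_arg (k : ℤ) (t : ℝ) :
    HasDerivAt (fun t : ℝ => k * (Real.pi / 2) * (t + 1)) (k * (Real.pi / 2)) t := by
  simpa using ((hasDerivAt_id t).add_const 1).const_mul (k * (Real.pi / 2))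

theorem hasDerivAt_cosMode (k : ℤ) (t : ℝ) :
    HasDerivAt (cosMode k) (-(k * (Real.pi / 2)) * sinMode k t) t :=
  (hasDerivAt_mode_arg k t).cos.congr_deriv (by unfold sinMode; ring)

theorem hasDerivAt_sinMode (k : ℤ) (t : ℝ) :
    HasDerivAt (sinMode k) (k * (Real.pi / 2) * cosMode k t) t :=
  (hasDerivAt_mode_arg k t).sin.congr_deriv (by unfold cosMode; ring)

theorem cosMode_zero (t : ℝ) : cosMode 0 t = 1 := by simp [cosMode]

theorem cosMode_neg (k : ℤ) (t : ℝ) : cosMode (-k) t = cosMode k t := by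
  simp only [cosMode, Int.cast_neg, neg_mul, Real.cos_neg]

theorem sinMode_zero (t : ℝ) : sinMode 0 t = 0 := by simp [sinMode]

theorem sinMode_neg (k : ℤ) (t : ℝ) : sinMode (-k) t = -sinMode k t := by
  simp only [sinMode, Int.cast_neg, neg_mul, Real.sin_neg]

theorem sinMode_endpoint (k : ℤ) {s : ℝ} (hs : s ∈ ({-1, 1} : Set ℝ)) : sinMode k s = 0 := by
  rcases hs with rfl | rfl
  · simp [sinMode]
  · rw [sinMode, show (k : ℝ) * (Real.pi / 2) * (1 + 1) = k * Real.pi by ring, Real.sin_int_mul_pi]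

theorem cosMode_mul_cosMode (k l : ℤ) (t : ℝ) :
    cosMode k t * cosMode l t = (cosMode (k + l) t + cosMode (k - l) t) / 2 := by
  simp only [cosMode, Int.cast_add, Int.cast_sub, add_mul, sub_mul, Real.cos_add, Real.cos_sub]
  ring

theorem sinMode_mul_sinMode (k l : ℤ) (t : ℝ) :
    sinMode k t * sinMode l t = (cosMode (k - l) t - cosMode (k + l) t) / 2 := by
  simp only [cosMode, sinMode, Int.cast_add, Int.cast_sub, add_mul, sub_mul, Real.cos_add,
    Real.cos_sub]
  ring

theorem sinMode_mul_cosMode (k l : ℤ) (t : ℝ) :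
    sinMode k t * cosMode l t = (sinMode (k + l) t + sinMode (k - l) t) / 2 := by
  simp only [cosMode, sinMode, Int.cast_add, Int.cast_sub, add_mul, sub_mul, Real.sin_add,
    Real.sin_sub]
  ring

theorem integrable_arcLength_of_continuous {f : ℝ → ℝ} (hf : Continuous f) :
    Integrable f arcLength :=
  (memLp_two_arcLength_of_continuous hf).integrable (by norm_num)

theorem integral_cosMode (k : ℤ) : ∫ t, cosMode k t ∂arcLength = if k = 0 then 2 else 0 := by
  rw [integral_arcLength_eq_intervalIntegral]
  split_ifs with hk
  · subst hk
    simp only [cosMode_zero, intervalIntegral.integral_const, smul_eq_mul]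
    norm_num
  · have hk' : (k : ℝ) * (Real.pi / 2) ≠ 0 :=
      mul_ne_zero (Int.cast_ne_zero.2 hk) (by positivity)
    rw [intervalIntegral.integral_eq_sub_of_hasDerivAt
      (f := fun t => sinMode k t / (k * (Real.pi / 2)))
      (fun t _ => ((hasDerivAt_sinMode k t).div_const _).congr_deriv (mul_div_cancel_left₀ _ hk'))
      ((continuous_cosMode k).intervalIntegrable _ _),
      sinMode_endpoint k (by simp), sinMode_endpoint k (by simp), sub_self]

theorem integral_cosMode_mul_cosMode (k l : ℤ) : ∫ t, cosMode k t * cosMode l t ∂arcLength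
    = ((if k + l = 0 then 2 else 0) + (if k - l = 0 then 2 else 0)) / 2 := by
  simp only [cosMode_mul_cosMode]
  rw [integral_div, integral_add (integrable_arcLength_of_continuous (continuous_cosMode _))
    (integrable_arcLength_of_continuous (continuous_cosMode _)), integral_cosMode,
    integral_cosMode]

theorem integral_sinMode_mul_sinMode (k l : ℤ) : ∫ t, sinMode k t * sinMode l t ∂arcLength
    = ((if k - l = 0 then 2 else 0) - (if k + l = 0 then 2 else 0)) / 2 := by
  simp only [sinMode_mul_sinMode]
  rw [integral_div, integral_sub (integrable_arcLength_of_continuous (continuous_cosMode _))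
    (integrable_arcLength_of_continuous (continuous_cosMode _)), integral_cosMode,
    integral_cosMode]

/-- The factor normalizing the cosine mode of frequency `m` in `L²([-1,1])`. -/
noncomputable def cosNormalization (m : ℕ) : ℝ := if m = 0 then (√2)⁻¹ else 1

theorem integral_normalized_cosMode (m n : ℕ) :
    ∫ t, cosNormalization m * cosMode m t * (cosNormalization n * cosMode n t) ∂arcLength
      = if m = n then 1 else 0 := by
  have h : ∀ t, cosNormalization m * cosMode m t * (cosNormalization n * cosMode n t)
      = cosNormalization m * cosNormalization n * (cosMode m t * cosMode n t) := fun t => by ring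
  simp only [h]
  rw [integral_const_mul, integral_cosMode_mul_cosMode]
  rcases eq_or_ne m n with rfl | hmn
  · rcases Nat.eq_zero_or_pos m with rfl | hm
    · simp [cosNormalization, ← mul_inv]
    · have : ¬ ((m : ℤ) + m = 0) := by omega
      simp [cosNormalization, hm.ne', this]
  · have h1 : ¬ ((m : ℤ) + n = 0) := by omega
    have h2 : ¬ ((m : ℤ) - n = 0) := by omega
    simp [h1, h2, hmn]

theorem integral_sinMode_succ (m n : ℕ) :
    ∫ t, sinMode (m + 1) t * sinMode (n + 1) t ∂arcLength = if m = n then 1 else 0 := by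
  rw [integral_sinMode_mul_sinMode]
  have h1 : ¬ ((m : ℤ) + 1 + (n + 1) = 0) := by omega
  have h2 : ((m : ℤ) + 1 - (n + 1) = 0) ↔ m = n := by omega
  simp only [h1, h2, if_false]
  split_ifs <;> norm_num

/-! ### Products of modes on the square -/

/-- The product function `x ↦ a x₀ * b x₁` on the plane. -/
def tensor (a b : ℝ → ℝ) (x : Plane) : ℝ := a (x 0) * b (x 1)

theorem contDiff_tensor {a b : ℝ → ℝ} (ha : ContDiff ℝ ∞ a) (hb : ContDiff ℝ ∞ b) :
    ContDiff ℝ ∞ (tensor a b) :=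
  (ha.comp (contDiff_apply ℝ ℝ 0)).mul (hb.comp (contDiff_apply ℝ ℝ 1))

theorem continuous_tensor {a b : ℝ → ℝ} (ha : Continuous a) (hb : Continuous b) :
    Continuous (tensor a b) := by
  unfold tensor; fun_prop

theorem integral_tensor {a b : ℝ → ℝ} (ha : Continuous a) (hb : Continuous b) :
    ∫ x, tensor a b x ∂lebΩ = (∫ t, a t ∂arcLength) * ∫ t, b t ∂arcLength := by
  rw [integral_lebΩ_eq 0 (continuous_tensor ha hb)]
  simp only [tensor, edge_zero, Matrix.cons_val_zero, Matrix.cons_val_one]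
  simp only [integral_mul_const, integral_const_mul]

theorem integral_tensor_mul_tensor {a b c d : ℝ → ℝ} (ha : Continuous a) (hb : Continuous b)
    (hc : Continuous c) (hd : Continuous d) :
    ∫ x, tensor a b x * tensor c d x ∂lebΩ
      = (∫ t, a t * c t ∂arcLength) * ∫ t, b t * d t ∂arcLength := by
  rw [← integral_tensor (a := fun t => a t * c t) (b := fun t => b t * d t) (ha.mul hc)
    (hb.mul hd)]
  refine integral_congr_ae (ae_of_all _ fun x => ?_)
  simp only [tensor]
  ring

theorem partialDeriv_zero_tensor {a b : ℝ → ℝ} {a' : ℝ} {x : Plane} (ha : HasDerivAt a a' (x 0))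
    (hb : DifferentiableAt ℝ b (x 1)) : partialDeriv 0 (tensor a b) x = a' * b (x 1) := by
  have h1 : HasFDerivAt (fun y : Plane => y 0) (ContinuousLinearMap.proj (R := ℝ) 0) x :=
    hasFDerivAt_apply 0 x
  have h2 : HasFDerivAt (fun y : Plane => y 1) (ContinuousLinearMap.proj (R := ℝ) 1) x :=
    hasFDerivAt_apply 1 x
  have h := (ha.comp_hasFDerivAt x h1).mul (hb.hasDerivAt.comp_hasFDerivAt x h2)
  unfold partialDeriv
  rw [show tensor a b = (a ∘ fun y => y 0) * (b ∘ fun y => y 1) from rfl, h.fderiv]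
  simp [mul_comm]

theorem partialDeriv_one_tensor {a b : ℝ → ℝ} {b' : ℝ} {x : Plane}
    (ha : DifferentiableAt ℝ a (x 0)) (hb : HasDerivAt b b' (x 1)) :
    partialDeriv 1 (tensor a b) x = a (x 0) * b' := by
  have h1 : HasFDerivAt (fun y : Plane => y 0) (ContinuousLinearMap.proj (R := ℝ) 0) x :=
    hasFDerivAt_apply 0 x
  have h2 : HasFDerivAt (fun y : Plane => y 1) (ContinuousLinearMap.proj (R := ℝ) 1) x :=
    hasFDerivAt_apply 1 x
  have h := (ha.hasDerivAt.comp_hasFDerivAt x h1).mul (hb.comp_hasFDerivAt x h2)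
  unfold partialDeriv
  rw [show tensor a b = (a ∘ fun y => y 0) * (b ∘ fun y => y 1) from rfl, h.fderiv]
  simp

/-! ### Completeness of the modes -/

theorem injOn_cosMode_one : Set.InjOn (cosMode 1) (Set.Icc (-1) 1) := by
  intro s hs t ht hst
  have hmem : ∀ r ∈ Set.Icc (-1 : ℝ) 1, 1 * (Real.pi / 2) * (r + 1) ∈ Set.Icc 0 Real.pi := by
    rintro r ⟨h1, h2⟩
    constructor <;> nlinarith [Real.pi_pos]
  simp only [cosMode, Int.cast_one] at hst
  have := Real.injOn_cos (hmem s hs) (hmem t ht) hst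
  have hpi := Real.pi_pos
  nlinarith [mul_left_cancel₀ (by positivity : 1 * (Real.pi / 2) ≠ 0) this]

/-- By Stone–Weierstrass, linear combinations of products of cosine modes are uniformly dense
in the continuous functions on the square. -/
theorem exists_span_tensor_cosMode_near {g : Plane → ℝ} (hg : Continuous g) {ε : ℝ} (hε : 0 < ε) :
    ∃ f ∈ Submodule.span ℝ (Set.range fun k : ℤ × ℤ => tensor (cosMode k.1) (cosMode k.2)),
      ∀ x ∈ Ω, |f x - g x| < ε := by
  set S := Submodule.span ℝ (Set.range fun k : ℤ × ℤ => tensor (cosMode k.1) (cosMode k.2))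
    with hS
  have hmem : ∀ k l, tensor (cosMode k) (cosMode l) ∈ S := fun k l =>
    Submodule.subset_span ⟨(k, l), rfl⟩
  have hone : (1 : Plane → ℝ) ∈ S := by
    convert hmem 0 0 using 1
    ext x
    simp [tensor, cosMode_zero]
  have hmul : ∀ a b, a ∈ S → b ∈ S → a * b ∈ S := by
    intro a b ha hb
    have hle : S * S ≤ S := by
      rw [hS, Submodule.span_mul_span, Submodule.span_le, ← hS]
      rintro _ ⟨_, ⟨k, rfl⟩, _, ⟨l, rfl⟩, rfl⟩
      have : tensor (cosMode k.1) (cosMode k.2) * tensor (cosMode l.1) (cosMode l.2)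
          = (1 / 4 : ℝ) • (tensor (cosMode (k.1 + l.1)) (cosMode (k.2 + l.2))
            + tensor (cosMode (k.1 + l.1)) (cosMode (k.2 - l.2))
            + tensor (cosMode (k.1 - l.1)) (cosMode (k.2 + l.2))
            + tensor (cosMode (k.1 - l.1)) (cosMode (k.2 - l.2))) := by
        ext x
        simp only [tensor, Pi.mul_apply, Pi.smul_apply, Pi.add_apply, smul_eq_mul]
        rw [mul_mul_mul_comm, cosMode_mul_cosMode, cosMode_mul_cosMode]
        ring
      simp only [SetLike.mem_coe]
      rw [this]
      exact S.smul_mem _ (S.add_mem (S.add_mem (S.add_mem (hmem _ _) (hmem _ _)) (hmem _ _))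
        (hmem _ _))
    exact hle (Submodule.mul_mem_mul ha hb)
  -- The continuous functions on the square that are restrictions of elements of the span.
  let ρ : C(Ω, ℝ) →ₐ[ℝ] (Ω → ℝ) := ContinuousMap.coeFnAlgHom ℝ
  let r : (Plane → ℝ) →ₐ[ℝ] (Ω → ℝ) :=
    AlgHom.pi fun x => Pi.evalAlgHom ℝ (fun _ : Plane => ℝ) x
  let A : Subalgebra ℝ C(Ω, ℝ) := ((S.toSubalgebra hone hmul).map r).comap ρ
  have hA : ∀ k l, (⟨fun x : Ω => tensor (cosMode k) (cosMode l) x,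
      (continuous_tensor (continuous_cosMode k) (continuous_cosMode l)).comp
        continuous_subtype_val⟩ : C(Ω, ℝ)) ∈ A := fun k l => ⟨_, hmem k l, rfl⟩
  have hsep : A.SeparatesPoints := by
    intro x y hxy
    by_contra hcon
    have hev : ∀ k l, tensor (cosMode k) (cosMode l) x = tensor (cosMode k) (cosMode l) y := by
      intro k l
      by_contra hne
      exact hcon ⟨_, ⟨_, hA k l, rfl⟩, hne⟩
    refine hxy (Subtype.ext (funext (Fin.forall_fin_two.2 ⟨?_, ?_⟩)))
    · refine injOn_cosMode_one ⟨x.2.1 0, x.2.2 0⟩ ⟨y.2.1 0, y.2.2 0⟩ ?_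
      simpa [tensor, cosMode_zero] using hev 1 0
    · refine injOn_cosMode_one ⟨x.2.1 1, x.2.2 1⟩ ⟨y.2.1 1, y.2.2 1⟩ ?_
      simpa [tensor, cosMode_zero] using hev 0 1
  have : CompactSpace Ω := isCompact_iff_compactSpace.1 isCompact_Ω
  obtain ⟨⟨f, F, hF, hFf⟩, hf⟩ :=
    ContinuousMap.exists_mem_subalgebra_near_continuous_of_separatesPoints A hsep
      (fun x : Ω => g x) (hg.comp continuous_subtype_val) ε hε
  refine ⟨F, hF, fun x hx => ?_⟩
  have h1 := hf ⟨x, hx⟩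
  have h2 : F x = f ⟨x, hx⟩ := congrFun hFf ⟨x, hx⟩
  rwa [h2]

theorem integrable_mul_continuous {h f : Plane → ℝ} (hh : Integrable h lebΩ) (hf : Continuous f) :
    Integrable (fun x => h x * f x) lebΩ :=
  IntegrableOn.mul_continuousOn hh hf.continuousOn isCompact_Ω

/-- An integrable function on the square orthogonal to all products of cosine modes is zero. -/
theorem ae_eq_zero_of_integral_mul_tensor_cosMode {h : Plane → ℝ} (hh : Integrable h lebΩ)
    (h0 : ∀ k l : ℤ, ∫ x, h x * tensor (cosMode k) (cosMode l) x ∂lebΩ = 0) : h =ᵐ[lebΩ] 0 := by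
  have hspan : ∀ f ∈ Submodule.span ℝ
      (Set.range fun k : ℤ × ℤ => tensor (cosMode k.1) (cosMode k.2)),
      Continuous f ∧ ∫ x, h x * f x ∂lebΩ = 0 := by
    intro f hf
    induction hf using Submodule.span_induction with
    | mem f hf =>
      obtain ⟨k, rfl⟩ := hf
      exact ⟨continuous_tensor (continuous_cosMode _) (continuous_cosMode _), h0 _ _⟩
    | zero => exact ⟨continuous_zero, by simp⟩
    | add a b _ _ ha hb =>
      refine ⟨ha.1.add hb.1, ?_⟩
      simp only [Pi.add_apply, mul_add]
      rw [integral_add (integrable_mul_continuous hh ha.1) (integrable_mul_continuous hh hb.1),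
        ha.2, hb.2, add_zero]
    | smul c a _ ha =>
      refine ⟨ha.1.const_smul c, ?_⟩
      simp only [Pi.smul_apply, smul_eq_mul, mul_left_comm _ c]
      rw [integral_const_mul, ha.2, mul_zero]
  have hcont : ∀ g : Plane → ℝ, Continuous g → ∫ x, h x * g x ∂lebΩ = 0 := by
    intro g hg
    have hbound : ∀ ε > 0, |∫ x, h x * g x ∂lebΩ| ≤ ε * ∫ x, |h x| ∂lebΩ := by
      intro ε hε
      obtain ⟨f, hfS, hfg⟩ := exists_span_tensor_cosMode_near hg hε
      obtain ⟨hfc, hf0⟩ := hspan f hfS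
      have heq : ∫ x, h x * g x ∂lebΩ = ∫ x, h x * (g x - f x) ∂lebΩ := by
        simp only [mul_sub]
        rw [integral_sub (integrable_mul_continuous hh hg) (integrable_mul_continuous hh hfc),
          hf0, sub_zero]
      rw [heq, ← integral_const_mul]
      refine (norm_integral_le_integral_norm _).trans (integral_mono_ae
        (integrable_mul_continuous hh (hg.sub hfc)).norm (hh.abs.const_mul ε) ?_)
      refine (ae_restrict_iff' measurableSet_Ω).2 (ae_of_all _ fun x hx => ?_)
      simp only [Real.norm_eq_abs, abs_mul]
      rw [mul_comm]
      exact mul_le_mul_of_nonneg_right ((abs_sub_comm _ _).trans_lt (hfg x hx)).le (abs_nonneg _)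
    have hlim : Tendsto (fun ε : ℝ => ε * ∫ x, |h x| ∂lebΩ) (𝓝[>] 0) (𝓝 0) := by
      have : Tendsto (fun ε : ℝ => ε * ∫ x, |h x| ∂lebΩ) (𝓝 0) (𝓝 (0 * ∫ x, |h x| ∂lebΩ)) :=
        (continuous_id.mul continuous_const).tendsto 0
      rw [zero_mul] at this
      exact this.mono_left nhdsWithin_le_nhds
    exact abs_eq_zero.1 (le_antisymm (ge_of_tendsto hlim (eventually_mem_nhdsWithin.mono hbound))
      (abs_nonneg _))
  refine ae_eq_zero_of_integral_contDiff_smul_eq_zero hh.locallyIntegrable fun g hg _ => ?_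
  simpa only [smul_eq_mul, mul_comm] using hcont g hg.continuous

theorem sinMode_one_ne_zero {t : ℝ} (h1 : -1 < t) (h2 : t < 1) : sinMode 1 t ≠ 0 := by
  refine (Real.sin_pos_of_pos_of_lt_pi ?_ ?_).ne' <;> push_cast <;> nlinarith [Real.pi_pos]

/-- An integrable function on the square orthogonal to all products of sine modes is zero: its
product with the first sine mode, which does not vanish inside the square, is orthogonal to all
products of cosine modes. -/
theorem ae_eq_zero_of_integral_mul_tensor_sinMode {h : Plane → ℝ} (hh : Integrable h lebΩ)
    (h0 : ∀ k l : ℤ, ∫ x, h x * tensor (sinMode k) (sinMode l) x ∂lebΩ = 0) : h =ᵐ[lebΩ] 0 := by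
  have hc : ∀ k l, Continuous (tensor (sinMode k) (sinMode l)) := fun k l =>
    continuous_tensor (continuous_sinMode k) (continuous_sinMode l)
  have hz := ae_eq_zero_of_integral_mul_tensor_cosMode
    (integrable_mul_continuous hh (hc 1 1)) ?_
  · rw [lebΩ, ← Measure.restrict_congr_set interior_Ω_ae_eq] at hz ⊢
    filter_upwards [hz, ae_restrict_mem isOpen_interior.measurableSet] with x hx hxΩ
    rw [Ω, ← Set.pi_univ_Icc, interior_pi_set Set.finite_univ] at hxΩ
    simp only [interior_Icc] at hxΩ
    have hne : ∀ i, sinMode 1 (x i) ≠ 0 := fun i =>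
      sinMode_one_ne_zero (hxΩ i trivial).1 (hxΩ i trivial).2
    exact (mul_eq_zero.1 hx).resolve_right (mul_ne_zero (hne 0) (hne 1))
  · intro k l
    have heq : ∀ x, h x * tensor (sinMode 1) (sinMode 1) x * tensor (cosMode k) (cosMode l) x
        = (h x * tensor (sinMode (1 + k)) (sinMode (1 + l)) x
          + h x * tensor (sinMode (1 + k)) (sinMode (1 - l)) x
          + (h x * tensor (sinMode (1 - k)) (sinMode (1 + l)) x
          + h x * tensor (sinMode (1 - k)) (sinMode (1 - l)) x)) / 4 := by
      intro x
      simp only [tensor]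
      rw [mul_assoc, mul_mul_mul_comm, sinMode_mul_cosMode, sinMode_mul_cosMode]
      ring
    have hi : ∀ k l, Integrable (fun x => h x * tensor (sinMode k) (sinMode l) x) lebΩ :=
      fun k l => integrable_mul_continuous hh (hc k l)
    have hi₂ : ∀ k l l', Integrable (fun x => h x * tensor (sinMode k) (sinMode l) x
        + h x * tensor (sinMode k) (sinMode l') x) lebΩ := fun k l l' => (hi k l).add (hi k l')
    simp only [heq]
    rw [integral_div, integral_add (hi₂ _ _ _) (hi₂ _ _ _),
      integral_add (hi _ _) (hi _ _), integral_add (hi _ _) (hi _ _)]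
    simp [h0]

/-- Parseval's identity for the products of cosine modes. -/
theorem hasSum_integral_mul_cosMode {f g : Plane → ℝ} (hf : MemLp f 2 lebΩ)
    (hg : MemLp g 2 lebΩ) :
    HasSum (fun m : ℕ × ℕ => (cosNormalization m.1 * cosNormalization m.2) ^ 2 *
      ((∫ x, f x * tensor (cosMode m.1) (cosMode m.2) x ∂lebΩ) *
        ∫ x, g x * tensor (cosMode m.1) (cosMode m.2) x ∂lebΩ)) (∫ x, f x * g x ∂lebΩ) := by
  have hc : ∀ m : ℕ, Continuous fun t => cosNormalization m * cosMode m t := fun m =>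
    continuous_const.mul (continuous_cosMode m)
  have hpull : ∀ (h : Plane → ℝ) (m n : ℕ),
      ∫ x, h x * tensor (fun t => cosNormalization m * cosMode m t)
        (fun t => cosNormalization n * cosMode n t) x ∂lebΩ
      = cosNormalization m * cosNormalization n *
        ∫ x, h x * tensor (cosMode m) (cosMode n) x ∂lebΩ := by
    intro h m n
    rw [← integral_const_mul]
    refine integral_congr_ae (ae_of_all _ fun x => ?_)
    simp only [tensor]
    ring
  have hne : ∀ m, cosNormalization m ≠ 0 := by
    intro m
    unfold cosNormalization
    split_ifs <;> positivity
  have hs := hasSum_integral_mul_integral (μ := lebΩ)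
    (e := fun m : ℕ × ℕ => tensor (fun t => cosNormalization m.1 * cosMode m.1 t)
      (fun t => cosNormalization m.2 * cosMode m.2 t))
    (fun m => memLp_two_lebΩ_of_continuous (continuous_tensor (hc _) (hc _)))
    (fun m => by
      rw [integral_tensor_mul_tensor (hc _) (hc _) (hc _) (hc _), integral_normalized_cosMode,
        integral_normalized_cosMode]
      simp)
    (fun m n hmn => by
      rw [integral_tensor_mul_tensor (hc _) (hc _) (hc _) (hc _), integral_normalized_cosMode,
        integral_normalized_cosMode]
      rw [Ne, Prod.ext_iff, not_and_or] at hmn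
      rcases hmn with h | h <;> simp [h])
    (fun h hh h0 => ae_eq_zero_of_integral_mul_tensor_cosMode (hh.integrable (by norm_num))
      fun k l => by
        have habs : ∀ (k : ℤ) (t : ℝ), cosMode k t = cosMode (k.natAbs : ℤ) t := by
          intro k t
          rcases Int.natAbs_eq k with hk | hk
          · rw [← hk]
          · conv_lhs => rw [hk, cosMode_neg]
        have := h0 (k.natAbs, l.natAbs)
        rw [hpull] at this
        have := (mul_eq_zero.1 this).resolve_left (mul_ne_zero (hne _) (hne _))
        simpa only [tensor, ← habs] using this)
    hf hg
  simp only [hpull] at hs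
  convert hs using 2 with m
  ring

/-- Parseval's identity for the products of sine modes. -/
theorem hasSum_integral_mul_sinMode {f g : Plane → ℝ} (hf : MemLp f 2 lebΩ)
    (hg : MemLp g 2 lebΩ) :
    HasSum (fun m : ℕ × ℕ =>
      (∫ x, f x * tensor (sinMode (m.1 + 1)) (sinMode (m.2 + 1)) x ∂lebΩ) *
        ∫ x, g x * tensor (sinMode (m.1 + 1)) (sinMode (m.2 + 1)) x ∂lebΩ)
      (∫ x, f x * g x ∂lebΩ) := by
  have hc : ∀ m : ℕ, Continuous (sinMode (m + 1)) := fun m => continuous_sinMode _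
  refine hasSum_integral_mul_integral (μ := lebΩ)
    (e := fun m : ℕ × ℕ => tensor (sinMode (m.1 + 1)) (sinMode (m.2 + 1)))
    (fun m => memLp_two_lebΩ_of_continuous (continuous_tensor (hc _) (hc _)))
    (fun m => by
      rw [integral_tensor_mul_tensor (hc _) (hc _) (hc _) (hc _), integral_sinMode_succ,
        integral_sinMode_succ]
      simp)
    (fun m n hmn => by
      rw [integral_tensor_mul_tensor (hc _) (hc _) (hc _) (hc _), integral_sinMode_succ,
        integral_sinMode_succ]
      rw [Ne, Prod.ext_iff, not_and_or] at hmn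
      rcases hmn with h | h <;> simp [h])
    (fun h hh h0 => ae_eq_zero_of_integral_mul_tensor_sinMode (hh.integrable (by norm_num)) ?_)
    hf hg
  -- Up to a sign, every sine mode is zero or has a positive frequency.
  have hsign : ∀ k : ℤ, ∃ (c : ℝ) (m : ℕ), ∀ t, sinMode k t = c * sinMode (m + 1) t := by
    intro k
    rcases lt_trichotomy k 0 with hk | rfl | hk
    · refine ⟨-1, (-k - 1).toNat, fun t => ?_⟩
      rw [show (((-k - 1).toNat : ℤ) + 1) = -k by omega, sinMode_neg]
      ring
    · exact ⟨0, 0, fun t => by rw [sinMode_zero, zero_mul]⟩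
    · refine ⟨1, (k - 1).toNat, fun t => ?_⟩
      rw [show (((k - 1).toNat : ℤ) + 1) = k by omega, one_mul]
  intro k l
  obtain ⟨c, m, hcm⟩ := hsign k
  obtain ⟨d, n, hdn⟩ := hsign l
  have heq : ∀ x, h x * tensor (sinMode k) (sinMode l) x
      = c * d * (h x * tensor (sinMode (m + 1)) (sinMode (n + 1)) x) := by
    intro x
    simp only [tensor, hcm, hdn]
    ring
  simp only [heq]
  rw [integral_const_mul, h0 (m, n), mul_zero]

/-! ### The Hessian determinant -/

/-- Integration by parts without boundary terms: on each of the two edges orthogonal to the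
direction of differentiation, the trace or the test function vanishes. -/
theorem IsTrace.integral_weakPartial_mul_eq_neg {v τ : Plane → ℝ} (h : IsTrace v τ) (i : Fin 2)
    {f : Plane → ℝ} (hf : ContDiff ℝ ∞ f)
    (h0 : ∀ s ∈ ({-1, 1} : Set ℝ), ∀ᵐ t ∂arcLength, τ (edge i s t) * f (edge i s t) = 0) :
    ∫ x, weakPartial i v x * f x ∂lebΩ = -∫ x, v x * partialDeriv i f x ∂lebΩ := by
  have key := h.integral_weakPartial_mul i hf
  rw [integral_eq_zero_of_ae (h0 1 (by simp)), integral_eq_zero_of_ae (h0 (-1) (by simp)),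
    sub_zero] at key
  linarith

/-- If `p` vanishes on the edges `x₀ = ±1` and `q` vanishes on the edges `x₁ = ±1`, then the
Jacobian determinant of `(p, q)` has zero integral. Both sides are expanded by Parseval's identity,
the left one in cosine modes and the right one in sine modes; integration by parts shows that
the two series have the same nonzero terms. -/
theorem integral_weakPartial_mul_weakPartial {p q τ σ : Plane → ℝ} (hp : IsTrace p τ)
    (hq : IsTrace q σ)
    (hτ : ∀ s ∈ ({-1, 1} : Set ℝ), ∀ᵐ t ∂arcLength, τ (edge 0 s t) = 0)
    (hσ : ∀ s ∈ ({-1, 1} : Set ℝ), ∀ᵐ t ∂arcLength, σ (edge 1 s t) = 0) :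
    ∫ x, weakPartial 0 p x * weakPartial 1 q x ∂lebΩ
      = ∫ x, weakPartial 1 p x * weakPartial 0 q x ∂lebΩ := by
  have hcos : ∀ k l, ContDiff ℝ ∞ (tensor (cosMode k) (cosMode l)) := fun k l =>
    contDiff_tensor (contDiff_cosMode k) (contDiff_cosMode l)
  have hsin : ∀ k l, ContDiff ℝ ∞ (tensor (sinMode k) (sinMode l)) := fun k l =>
    contDiff_tensor (contDiff_sinMode k) (contDiff_sinMode l)
  have hdcos : ∀ k t, DifferentiableAt ℝ (cosMode k) t := fun k t =>
    (hasDerivAt_cosMode k t).differentiableAt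
  have hdsin : ∀ k t, DifferentiableAt ℝ (sinMode k) t := fun k t =>
    (hasDerivAt_sinMode k t).differentiableAt
  set P : ℤ → ℤ → ℝ := fun k l => ∫ x, p x * tensor (sinMode k) (cosMode l) x ∂lebΩ with hP
  set Q : ℤ → ℤ → ℝ := fun k l => ∫ x, q x * tensor (cosMode k) (sinMode l) x ∂lebΩ with hQ
  have hp0 : ∀ k l : ℤ, ∫ x, weakPartial 0 p x * tensor (cosMode k) (cosMode l) x ∂lebΩ
      = k * (Real.pi / 2) * P k l := by
    intro k l
    rw [hp.integral_weakPartial_mul_eq_neg 0 (hcos k l) fun s hs => (hτ s hs).mono fun t ht => by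
      rw [ht, zero_mul], hP, ← integral_const_mul, ← integral_neg]
    refine integral_congr_ae (ae_of_all _ fun x => ?_)
    simp only [partialDeriv_zero_tensor (hasDerivAt_cosMode k (x 0)) (hdcos l (x 1)), tensor]
    ring
  have hp1 : ∀ k l : ℤ, ∫ x, weakPartial 1 p x * tensor (sinMode k) (sinMode l) x ∂lebΩ
      = -(l * (Real.pi / 2)) * P k l := by
    intro k l
    rw [hp.integral_weakPartial_mul_eq_neg 1 (hsin k l) fun s hs => ae_of_all _ fun t => by
      simp [tensor, edge_one, sinMode_endpoint l hs], hP, ← integral_const_mul, ← integral_neg]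
    refine integral_congr_ae (ae_of_all _ fun x => ?_)
    simp only [partialDeriv_one_tensor (hdsin k (x 0)) (hasDerivAt_sinMode l (x 1)), tensor]
    ring
  have hq1 : ∀ k l : ℤ, ∫ x, weakPartial 1 q x * tensor (cosMode k) (cosMode l) x ∂lebΩ
      = l * (Real.pi / 2) * Q k l := by
    intro k l
    rw [hq.integral_weakPartial_mul_eq_neg 1 (hcos k l) fun s hs => (hσ s hs).mono fun t ht => by
      rw [ht, zero_mul], hQ, ← integral_const_mul, ← integral_neg]
    refine integral_congr_ae (ae_of_all _ fun x => ?_)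
    simp only [partialDeriv_one_tensor (hdcos k (x 0)) (hasDerivAt_cosMode l (x 1)), tensor]
    ring
  have hq0 : ∀ k l : ℤ, ∫ x, weakPartial 0 q x * tensor (sinMode k) (sinMode l) x ∂lebΩ
      = -(k * (Real.pi / 2)) * Q k l := by
    intro k l
    rw [hq.integral_weakPartial_mul_eq_neg 0 (hsin k l) fun s hs => ae_of_all _ fun t => by
      simp [tensor, edge_zero, sinMode_endpoint k hs], hQ, ← integral_const_mul, ← integral_neg]
    refine integral_congr_ae (ae_of_all _ fun x => ?_)
    simp only [partialDeriv_zero_tensor (hasDerivAt_sinMode k (x 0)) (hdsin l (x 1)), tensor]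
    ring
  have hsum_cos := hasSum_integral_mul_cosMode (hp.memH1.memLp_weakPartial 0)
    (hq.memH1.memLp_weakPartial 1)
  have hsum_sin := hasSum_integral_mul_sinMode (hp.memH1.memLp_weakPartial 1)
    (hq.memH1.memLp_weakPartial 0)
  simp only [hp0, hq1] at hsum_cos
  simp only [hp1, hq0] at hsum_sin
  -- The terms of the cosine series with a zero frequency vanish, so it may be reindexed.
  have hinj : Function.Injective (Prod.map Nat.succ Nat.succ) :=
    Nat.succ_injective.prodMap Nat.succ_injective
  rw [← hinj.hasSum_iff] at hsum_cos
  · refine hsum_cos.unique ?_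
    convert hsum_sin using 2 with m
    simp only [Function.comp_apply, Prod.map_fst, Prod.map_snd, cosNormalization, Nat.succ_ne_zero,
      if_false, Nat.succ_eq_add_one]
    push_cast
    ring
  · rintro ⟨m, n⟩ hmn
    rcases m with _ | m
    · simp
    rcases n with _ | n
    · simp
    exact absurd ⟨(m, n), rfl⟩ hmn

end SquareReg

theorem mainTheorem1 (u : SquareReg.Plane → ℝ) (hu : u ∈ SquareReg.X₂) :
    MeasureTheory.IntegrableOn (fun x => SquareReg.laplacian u x ^ 2) SquareReg.Ω ∧
      MeasureTheory.IntegrableOn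
        (fun x => SquareReg.frobSq (SquareReg.hessian u x)) SquareReg.Ω ∧
      SquareReg.R₂ u = SquareReg.R₃ u := by
  open SquareReg in
  obtain ⟨⟨-, hu₁⟩, τ, hτ, hν⟩ := hu
  have hH : ∀ j, MemH1 (weakPartial j u) := fun j => (hτ j).memH1
  have hL : ∀ i j, MemLp (weakPartial i (weakPartial j u)) 2 lebΩ := fun i j =>
    (hH j).memLp_weakPartial i
  have hmul : ∀ i j k l, Integrable (fun x => weakPartial i (weakPartial j u) x *
      weakPartial k (weakPartial l u) x) lebΩ := fun i j k l => (hL i j).integrable_mul (hL k l)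
  have hlap : Integrable (fun x => laplacian u x ^ 2) lebΩ :=
    (memLp_finsetSum _ fun i _ => hL i i).integrable_sq
  have hfrob : Integrable (fun x => frobSq (hessian u x)) lebΩ :=
    integrable_finsetSum _ fun i _ => integrable_finsetSum _ fun j _ => (hL i j).integrable_sq
  -- Only the normal component of the gradient enters the boundary condition on each edge.
  have hzero : ∀ i, ∀ s ∈ ({-1, 1} : Set ℝ), ∀ᵐ t ∂arcLength, τ i (edge i s t) = 0 := by
    intro i s hs
    have hs0 : s ≠ 0 := by rcases hs with rfl | rfl <;> norm_num
    filter_upwards [hν i s hs] with t ht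
    rw [Finset.sum_eq_single i (fun j _ hj => by simp [outerNormal, hj]) (by simp)] at ht
    simpa [outerNormal, hs0] using ht
  have hdet := integral_weakPartial_mul_weakPartial (hτ 0) (hτ 1) (hzero 0) (hzero 1)
  have hsymm : weakPartial 0 (weakPartial 1 u) =ᵐ[lebΩ] weakPartial 1 (weakPartial 0 u) :=
    weakPartial_comm 0 1 ((hu₁ 0).imp fun _ h => h.1) ((hu₁ 1).imp fun _ h => h.1) (hH 0) (hH 1)
  refine ⟨hlap, hfrob, ?_⟩
  rw [R₂, R₃]
  congr 1
  change ∫ x, laplacian u x ^ 2 ∂lebΩ = ∫ x, frobSq (hessian u x) ∂lebΩ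
  rw [← sub_eq_zero, ← integral_sub hlap hfrob]
  have hae : (fun x => laplacian u x ^ 2 - frobSq (hessian u x)) =ᵐ[lebΩ] fun x =>
      2 * (weakPartial 0 (weakPartial 0 u) x * weakPartial 1 (weakPartial 1 u) x
        - weakPartial 1 (weakPartial 0 u) x * weakPartial 0 (weakPartial 1 u) x) := by
    filter_upwards [hsymm] with x hx
    simp only [laplacian, frobSq, hessian, Fin.sum_univ_two, Matrix.of_apply, hx]
    ring
  rw [integral_congr_ae hae, integral_const_mul, integral_sub (hmul 0 0 1 1) (hmul 1 0 0 1), hdet,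
    sub_self, mul_zero]
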